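/- Words are finite sequences over an arbitrary alphabet. For a word $w$, let $|w|$ be its length and $\mathrm{Alph}(w)$ the set of letters occurring in $w$. A factor of $w$ is a contiguous subword of $w$, and a $k$-power is a word of the form $u^k = uu\cdots u$ ($k$ copies of a word $u$). Let $N_k(w)$ be the number of distinct nonempty factors of $w$ that are $k$-powers, and let $N(n,k)$ be the maximum of $N_k(w)$ over all words $w$ of length $n$. **Theorem (Upper Bound).** Let $k$ be an integer greater than $1$. For any word $w$, $$N_k(w) \le \frac{|w| - |\mathrm{Alph}(w)|}{k-1}.$$ Consequently, for any integer $n \ge 1$, $$N(n,k) \le \frac{n-1}{k-1}.$$ -/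

import Mathlib

universe u

/-- The `k`-th power `u ^ k = u u ⋯ u` (`k` copies) of a finite word `u`. -/
def wordPow {α : Type*} (u : List α) (k : ℕ) : List α :=
  (List.replicate k u).flatten

/-- The set of nonempty factors (contiguous subwords) of `w` that are `k`-powers of some word. -/
def kPowerFactors {α : Type*} (k : ℕ) (w : List α) : Set (List α) :=
  {x | x ≠ [] ∧ x <:+: w ∧ ∃ u : List α, x = wordPow u k}

/-- `N_k(w)`: the number of distinct nonempty `k`-power factors of `w`. -/
noncomputable def numKPowers {α : Type*} (k : ℕ) (w : List α) : ℕ :=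
  (kPowerFactors k w).ncard

/-- `Alph(w)`: the set of letters occurring in `w`. -/
def wordAlph {α : Type*} (w : List α) : Set α :=
  {a | a ∈ w}

/-- The values `N_k(w)`, where `w` ranges over all words of length `n` over all alphabets. -/
def kPowerCounts (n k : ℕ) : Set ℕ :=
  {m | ∃ (α : Type u) (w : List α), w.length = n ∧ numKPowers k w = m}

/-- `N(n, k)`: the maximum of `N_k(w)` over all words `w` of length `n`
(`maxKPowers_isGreatest` shows that the supremum is an attained maximum). -/
noncomputable def maxKPowers (n k : ℕ) : ℕ :=
  sSup (kPowerCounts.{u} n k)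

theorem kPowerFactors_subset {α : Type*} (k : ℕ) (w : List α) :
    kPowerFactors k w ⊆ (fun p : ℕ × ℕ => (w.drop p.1).take p.2) ''
      (↑(Finset.range (w.length + 1) ×ˢ Finset.range (w.length + 1)) : Set (ℕ × ℕ)) := by
  rintro x ⟨-, ⟨s, t, rfl⟩, -⟩
  refine ⟨(s.length, x.length), ?_, by simp⟩
  simp only [Finset.coe_product, Set.mem_prod, Finset.mem_coe, Finset.mem_range,
    List.length_append]
  omega

theorem kPowerFactors_finite {α : Type*} (k : ℕ) (w : List α) :
    (kPowerFactors k w).Finite :=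
  ((Finset.finite_toSet _).image _).subset (kPowerFactors_subset k w)

theorem wordAlph_finite {α : Type*} (w : List α) : (wordAlph w).Finite :=
  List.finite_toSet w

theorem maxKPowers_isGreatest (n k : ℕ) :
    IsGreatest (kPowerCounts.{u} n k) (maxKPowers.{u} n k) := by
  have hb : BddAbove (kPowerCounts.{u} n k) := by
    refine ⟨(n + 1) * (n + 1), ?_⟩
    rintro m ⟨α, w, rfl, rfl⟩
    refine (Set.ncard_le_ncard (kPowerFactors_subset k w)
      ((Finset.finite_toSet _).image _)).trans ?_
    refine (Set.ncard_image_le (Finset.finite_toSet _)).trans ?_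
    rw [Set.ncard_coe_finset]
    simp
  have hne : (kPowerCounts.{u} n k).Nonempty :=
    ⟨_, PUnit, List.replicate n PUnit.unit, by simp, rfl⟩
  exact ⟨Nat.sSup_mem hne hb, fun m hm => le_csSup hb hm⟩

/-! For each order m ≥ 1, the Rauzy graph of w has the factors of length m as vertices and those of
length m + 1 as edges. A periodic word of period at most m whose windows of length m + 1 all occur
in w traces a small circuit; once the letters are ordered, its necklace represents it. Deleting the
largest edge of every small circuit leaves the graph connected (`prunedRauzy_reachable_of_edge`), so
at most |E| - |V| + 1 edges are deleted. Summed over m, this telescopes to at most |w| - |Alph(w)|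
(`sum_card_circuitTops_le`).

Each nonempty k-power is a window of a necklace, and N powers sharing a necklace force at least (k -
1)N orders at which it gives a small circuit (`mul_card_le_card_circuitOrders`). Distinct necklaces
have distinct largest edges (`IsNecklace.eq_of_window_eq`), so these counts add up. -/

open Function

/-! ### Periods and windows of infinite words -/

/-- The left shift on infinite words. -/
def shiftSeq {α : Type*} (f : ℕ → α) : ℕ → α := fun j => f (j + 1)

theorem shiftSeq_iterate {α : Type*} (f : ℕ → α) (n j : ℕ) : shiftSeq^[n] f j = f (j + n) := by
  induction n generalizing f with
  | zero => rfl
  | succ n ih => rw [iterate_succ_apply, ih]; simp [shiftSeq, add_assoc]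

/-- The least period of an infinite word, `0` if it is not periodic. -/
noncomputable def wordPeriod {α : Type*} (f : ℕ → α) : ℕ := minimalPeriod shiftSeq f

theorem apply_add_wordPeriod_mul {α : Type*} (f : ℕ → α) (c i : ℕ) :
    f (i + wordPeriod f * c) = f i := by
  rw [← shiftSeq_iterate f, wordPeriod]
  exact congrFun ((isPeriodicPt_minimalPeriod shiftSeq f).mul_const c) i

theorem apply_add_wordPeriod {α : Type*} (f : ℕ → α) (i : ℕ) : f (i + wordPeriod f) = f i := by
  simpa using apply_add_wordPeriod_mul f 1 i

theorem apply_mod_wordPeriod {α : Type*} (f : ℕ → α) (i : ℕ) : f (i % wordPeriod f) = f i := by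
  conv_rhs => rw [← Nat.mod_add_div i (wordPeriod f), apply_add_wordPeriod_mul f]

theorem wordPeriod_dvd {α : Type*} {f : ℕ → α} {q : ℕ} (h : ∀ i, f (i + q) = f i) :
    wordPeriod f ∣ q :=
  IsPeriodicPt.minimalPeriod_dvd (funext fun i => by rw [shiftSeq_iterate, h])

/-- The window of length `L` of the infinite word `f` that starts at position `i`. -/
def window {α : Type*} (f : ℕ → α) (i L : ℕ) : List α := (List.range' i L).map f

@[simp] theorem length_window {α : Type*} (f : ℕ → α) (i L : ℕ) : (window f i L).length = L := by
  simp [window]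

@[simp] theorem getElem_window {α : Type*} (f : ℕ → α) (i L j : ℕ)
    (h : j < (window f i L).length) : (window f i L)[j] = f (i + j) := by
  simp [window]

theorem window_eq_iff {α : Type*} {f g : ℕ → α} {i i' L : ℕ} :
    window f i L = window g i' L ↔ ∀ j < L, f (i + j) = g (i' + j) := by
  constructor
  · intro h j hj
    have := List.getElem_of_eq h (i := j) (by simpa using hj)
    simpa using this
  · intro h
    refine List.ext_getElem (by simp) fun j h₁ h₂ => ?_
    simpa using h j (by simpa using h₁)

theorem take_window {α : Type*} (f : ℕ → α) (i m : ℕ) :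
    (window f i (m + 1)).take m = window f i m :=
  List.ext_getElem (by simp) fun j h₁ h₂ => by simp

theorem drop_window {α : Type*} (f : ℕ → α) (i m : ℕ) :
    (window f i (m + 1)).drop 1 = window f (i + 1) m :=
  List.ext_getElem (by simp) fun j h₁ h₂ => by
    rw [List.getElem_drop, getElem_window, getElem_window]; congr 1; omega

theorem window_append {α : Type*} (f : ℕ → α) (i a b : ℕ) :
    window f i (a + b) = window f i a ++ window f (i + a) b := by
  simp [window, ← List.map_append]

theorem window_infix_window {α : Type*} (f : ℕ → α) {i a L L' : ℕ} (h : a + L ≤ L') :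
    window f (i + a) L <:+: window f i L' := by
  obtain ⟨b, rfl⟩ := Nat.exists_eq_add_of_le h
  exact ⟨window f i a, window f (i + a + L) b, by
    rw [window_append, window_append, add_assoc]⟩

theorem window_mod_wordPeriod {α : Type*} (f : ℕ → α) (i L : ℕ) :
    window f (i % wordPeriod f) L = window f i L := by
  rw [window_eq_iff]
  intro j _
  conv_rhs => rw [← Nat.mod_add_div i (wordPeriod f), add_right_comm, apply_add_wordPeriod_mul f]

/-! ### Necklaces -/

section Necklace

variable {α : Type*} [LinearOrder α]

/-- A periodic infinite word that is lexicographically maximal among its shifts. -/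
def IsNecklace (f : ℕ → α) : Prop :=
  0 < wordPeriod f ∧ ∀ i, toLex (shiftSeq^[i] f) ≤ toLex f

theorem IsNecklace.not_gt {f : ℕ → α} (hf : IsNecklace f) (a i : ℕ)
    (h : ∀ j < i, f (a + j) = f j) : f (a + i) ≤ f i := by
  by_contra! hlt
  refine (hf.2 a).not_gt ⟨i, fun j hj => ?_, ?_⟩
  · change f j = shiftSeq^[a] f j
    rw [shiftSeq_iterate, add_comm, h j hj]
  · change f i < shiftSeq^[a] f i
    rwa [shiftSeq_iterate, add_comm]

/-- A necklace sharing a prefix of length at least `wordPeriod g` with `g` has no smaller period. -/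
theorem IsNecklace.wordPeriod_le_of_agree {f g : ℕ → α} (hf : IsNecklace f) (hg : IsNecklace g)
    {L : ℕ} (hL : wordPeriod g ≤ L) (h : ∀ j < L, f j = g j) : wordPeriod g ≤ wordPeriod f := by
  by_contra! hlt
  set p := wordPeriod f with hp
  set q := wordPeriod g with hq
  -- The period `p` of the common prefix propagates: maximality of `g` against its shifts by `p` and
  -- by `q - p` gives the two inequalities.
  have hgp : ∀ i, g (p + i) = g i := by
    intro i
    induction i using Nat.strong_induction_on with
    | _ i ih =>
      rcases lt_or_ge (p + i) q with hi | hi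
      · rw [← h _ (by omega), ← h _ (by omega), add_comm, hp, apply_add_wordPeriod f]
      · refine le_antisymm (hg.not_gt p i ih) ?_
        obtain ⟨j, hj⟩ := Nat.exists_eq_add_of_le hi
        have hstep : ∀ j', g (q + j') = g j' := fun j' => by
          rw [add_comm, hq, apply_add_wordPeriod g]
        have := hg.not_gt (q - p) j fun j' hj' => by
          rw [← ih (q - p + j') (by omega), show p + (q - p + j') = q + j' by omega, hstep]
        rw [hj, hstep]
        rwa [show q - p + j = i by omega] at this
  have hdvd : q ∣ p := wordPeriod_dvd fun i => by rw [add_comm, hgp]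
  exact absurd (Nat.le_of_dvd hf.1 hdvd) (by omega)

theorem IsNecklace.eq_of_window_eq {f g : ℕ → α} (hf : IsNecklace f) (hg : IsNecklace g) {L : ℕ}
    (hfL : wordPeriod f ≤ L) (hgL : wordPeriod g ≤ L) (h : window f 0 L = window g 0 L) :
    f = g := by
  have h' : ∀ j < L, f j = g j := by simpa [window_eq_iff] using h
  have hpq : wordPeriod f = wordPeriod g :=
    le_antisymm (hg.wordPeriod_le_of_agree hf hfL fun j hj => (h' j hj).symm)
      (hf.wordPeriod_le_of_agree hg hgL h')
  funext i
  rw [← apply_mod_wordPeriod f, ← apply_mod_wordPeriod g, hpq,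
    h' _ ((Nat.mod_lt _ hg.1).trans_le hgL)]

theorem IsNecklace.window_lt {f : ℕ → α} (hf : IsNecklace f) {i L : ℕ} (hi : 0 < i)
    (hip : i < wordPeriod f) (hL : wordPeriod f ≤ L) : window f i L < window f 0 L := by
  have hex : ∃ j, f (i + j) ≠ f j := by
    by_contra! hcon
    exact absurd (Nat.le_of_dvd hi (wordPeriod_dvd (f := f) fun j => by rw [add_comm, hcon])) (by omega)
  obtain ⟨n, hn, hmin⟩ : ∃ n, f (i + n) ≠ f n ∧ ∀ j < n, f (i + j) = f j := by
    classical
    exact ⟨Nat.find hex, Nat.find_spec hex, fun j hj => not_not.1 (Nat.find_min hex hj)⟩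
  -- Agreement over a full period would be agreement everywhere.
  have hlt : n < L := by
    by_contra! hle
    have h := hmin _ ((Nat.mod_lt n hf.1).trans_le (hL.trans hle))
    rw [apply_mod_wordPeriod f, ← apply_mod_wordPeriod f (i + _), Nat.add_mod_mod,
      apply_mod_wordPeriod f] at h
    exact hn h
  refine List.lt_iff_exists.2 (Or.inr ⟨n, by simpa, by simpa, fun j hj => ?_, ?_⟩)
  · simpa using hmin j hj
  · simpa using lt_of_le_of_ne (hf.not_gt i _ hmin) hn

/-- Every periodic infinite word is a shift of a necklace. -/
theorem exists_isNecklace (f : ℕ → α) (hf : 0 < wordPeriod f) :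
    ∃ g : ℕ → α, IsNecklace g ∧ wordPeriod g = wordPeriod f ∧ ∃ i, ∀ j, f j = g (i + j) := by
  obtain ⟨a, ha, hmax⟩ := Finset.exists_max_image (Finset.range (wordPeriod f))
    (fun a => toLex (shiftSeq^[a] f)) ⟨0, by simpa using hf⟩
  rw [Finset.mem_range] at ha
  have hper : wordPeriod (shiftSeq^[a] f) = wordPeriod f :=
    minimalPeriod_apply_iterate (minimalPeriod_pos_iff_mem_periodicPts.1 hf) a
  refine ⟨shiftSeq^[a] f, ⟨by rwa [hper], fun i => ?_⟩, hper, wordPeriod f - a, fun j => ?_⟩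
  · rw [← iterate_add_apply, ← iterate_mod_minimalPeriod_eq]
    exact hmax _ (Finset.mem_range.2 (Nat.mod_lt _ hf))
  · rw [shiftSeq_iterate, show wordPeriod f - a + j + a = j + wordPeriod f by omega,
      apply_add_wordPeriod f]

end Necklace

/-! ### Small circuits in Rauzy graphs -/

section Rauzy

variable {α : Type*} [LinearOrder α]

/-- The factors of length `L` of `w`. -/
def factors (w : List α) (L : ℕ) : Finset (List α) :=
  (Finset.range (w.length + 1 - L)).image fun i => (w.drop i).take L

theorem mem_factors {w v : List α} {L : ℕ} : v ∈ factors w L ↔ v <:+: w ∧ v.length = L := by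
  simp only [factors, Finset.mem_image, Finset.mem_range]
  constructor
  · rintro ⟨i, hi, rfl⟩
    exact ⟨(List.take_prefix _ _).isInfix.trans (List.drop_suffix _ _).isInfix, by simp; omega⟩
  · rintro ⟨⟨s, t, rfl⟩, rfl⟩
    exact ⟨s.length, by simp; omega, by simp⟩

theorem mem_factors_of_infix {w u v : List α} {L L' : ℕ} (hv : v ∈ factors w L) (h : u <:+: v)
    (hu : u.length = L') : u ∈ factors w L' :=
  mem_factors.2 ⟨h.trans (mem_factors.1 hv).1, hu⟩

theorem take_mem_factors {w v : List α} {m : ℕ} (h : v ∈ factors w (m + 1)) :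
    v.take m ∈ factors w m :=
  mem_factors_of_infix h (List.take_prefix _ _).isInfix (by simp [(mem_factors.1 h).2])

theorem drop_mem_factors {w v : List α} {m : ℕ} (h : v ∈ factors w (m + 1)) :
    v.drop 1 ∈ factors w m :=
  mem_factors_of_infix h (List.drop_suffix _ _).isInfix (by simp [(mem_factors.1 h).2])

/-- All windows of length `m + 1` of `f` are factors of `w`. In the Rauzy graph of order `m`, they
form a circuit. -/
def HasCircuit (w : List α) (f : ℕ → α) (m : ℕ) : Prop :=
  ∀ i, window f i (m + 1) ∈ factors w (m + 1)

open Classical in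
/-- The largest edges of the small circuits of the Rauzy graph of order `m`. -/
noncomputable def circuitTops (w : List α) (m : ℕ) : Finset (List α) :=
  (factors w (m + 1)).filter fun v =>
    ∃ f, IsNecklace f ∧ wordPeriod f ≤ m ∧ HasCircuit w f m ∧ v = window f 0 (m + 1)

theorem circuitTops_subset (w : List α) (m : ℕ) : circuitTops w m ⊆ factors w (m + 1) := by
  classical exact Finset.filter_subset _ _

/-- The undirected Rauzy graph of order `m` without the largest edges of its small circuits. -/
def prunedRauzy (w : List α) (m : ℕ) : SimpleGraph (factors w m) :=
  .fromEdgeSet (Set.range fun v : (factors w (m + 1) \ circuitTops w m : Finset (List α)) =>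
    s(⟨v.1.take m, take_mem_factors (Finset.mem_sdiff.1 v.2).1⟩,
      ⟨v.1.drop 1, drop_mem_factors (Finset.mem_sdiff.1 v.2).1⟩))

/-- A deleted edge is bypassed by the rest of its circuit, whose edges are strictly smaller; hence a
least counterexample cannot exist, even though circuits may share edges. -/
theorem prunedRauzy_reachable_of_edge {w v : List α} {m : ℕ} (hv : v ∈ factors w (m + 1)) :
    (prunedRauzy w m).Reachable ⟨v.take m, take_mem_factors hv⟩ ⟨v.drop 1, drop_mem_factors hv⟩ := by
  by_contra hcon
  classical
  set bad := (factors w (m + 1)).filter fun v => ∃ hv : v ∈ factors w (m + 1),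
    ¬ (prunedRauzy w m).Reachable ⟨v.take m, take_mem_factors hv⟩ ⟨v.drop 1, drop_mem_factors hv⟩
    with hbad
  obtain ⟨e, he, hmin⟩ := bad.exists_min_image id ⟨v, Finset.mem_filter.2 ⟨hv, hv, hcon⟩⟩
  obtain ⟨he₁, _, hebad⟩ := Finset.mem_filter.1 he
  refine hebad ?_
  by_cases htop : e ∈ circuitTops w m
  · obtain ⟨-, f, hf, hfm, hcirc, rfl⟩ := Finset.mem_filter.1 htop
    have hvert : ∀ i, window f i m ∈ factors w m := fun i => by
      simpa only [take_window] using take_mem_factors (hcirc i)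
    have hstep : ∀ i, 0 < i → i < wordPeriod f →
        (prunedRauzy w m).Reachable ⟨_, hvert i⟩ ⟨_, hvert (i + 1)⟩ := by
      intro i hi hip
      by_contra hn
      have hmem : window f i (m + 1) ∈ bad :=
        Finset.mem_filter.2 ⟨hcirc i, hcirc i, by simpa only [take_window, drop_window] using hn⟩
      exact (hmin _ hmem).not_gt (hf.window_lt hi hip (by omega))
    have hpath : ∀ i, i < wordPeriod f →
        (prunedRauzy w m).Reachable ⟨_, hvert 1⟩ ⟨_, hvert (i + 1)⟩ := by
      intro i
      induction i with
      | zero => exact fun _ => .rfl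
      | succ i ih => exact fun hi => (ih (by omega)).trans (hstep _ (by omega) hi)
    have hend := hpath (wordPeriod f - 1) (Nat.sub_lt hf.1 one_pos)
    have h0 : window f (wordPeriod f - 1 + 1) m = window f 0 m := by
      rw [Nat.sub_add_cancel hf.1, ← window_mod_wordPeriod, Nat.mod_self]
    simp only [h0] at hend
    simpa only [take_window, drop_window] using hend.symm
  · by_cases heq : e.take m = e.drop 1
    · simp only [heq]; exact .rfl
    · refine SimpleGraph.Adj.reachable ?_
      rw [prunedRauzy, SimpleGraph.fromEdgeSet_adj]
      exact ⟨⟨⟨e, Finset.mem_sdiff.2 ⟨he₁, htop⟩⟩, rfl⟩, fun h => heq (congrArg Subtype.val h)⟩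

theorem prunedRauzy_connected {w : List α} {m : ℕ} (hm : m ≤ w.length) :
    (prunedRauzy w m).Connected := by
  have hpos : ∀ i, i + m ≤ w.length → (w.drop i).take m ∈ factors w m := fun i hi =>
    Finset.mem_image.2 ⟨i, by simp; omega, rfl⟩
  have hreach : ∀ i (hi : i + m ≤ w.length),
      (prunedRauzy w m).Reachable ⟨_, hpos 0 (by omega)⟩ ⟨_, hpos i hi⟩ := by
    intro i
    induction i with
    | zero => exact fun _ => .rfl
    | succ i ih =>
      intro hi
      refine (ih (by omega)).trans ?_
      have hv : (w.drop i).take (m + 1) ∈ factors w (m + 1) :=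
        Finset.mem_image.2 ⟨i, by simp; omega, rfl⟩
      have := prunedRauzy_reachable_of_edge hv
      simpa only [List.take_take, List.drop_take, List.drop_drop, Nat.add_sub_cancel,
        min_eq_left (Nat.le_succ m)] using this
  have hall : ∀ x, (prunedRauzy w m).Reachable ⟨_, hpos 0 (by omega)⟩ x := by
    rintro ⟨x, hx⟩
    obtain ⟨i, hi, rfl⟩ := Finset.mem_image.1 hx
    exact hreach i (by simp at hi; omega)
  have : Nonempty (factors w m) := ⟨⟨_, hpos 0 (by omega)⟩⟩
  exact .mk fun x y => (hall x).symm.trans (hall y)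

/-- A connected graph has at least |V| - 1 edges. -/
theorem card_circuitTops_add_card_factors_le {w : List α} {m : ℕ} (hm : m ≤ w.length) :
    (circuitTops w m).card + (factors w m).card ≤ (factors w (m + 1)).card + 1 := by
  have h₁ := (prunedRauzy_connected hm).card_vert_le_card_edgeSet_add_one
  have h₂ : Nat.card (prunedRauzy w m).edgeSet ≤
      (factors w (m + 1) \ circuitTops w m).card := by
    rw [prunedRauzy, SimpleGraph.edgeSet_fromEdgeSet, Nat.card_coe_set_eq]
    refine (Set.ncard_le_ncard Set.sdiff_subset (Set.finite_range _)).trans ?_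
    rw [← Set.image_univ]
    refine (Set.ncard_image_le Set.finite_univ).trans ?_
    rw [Set.ncard_univ, Nat.card_eq_fintype_card, Fintype.card_coe]
  rw [Finset.card_sdiff_of_subset (circuitTops_subset w m)] at h₂
  have h₃ : (circuitTops w m).card ≤ (factors w (m + 1)).card :=
    Finset.card_le_card (circuitTops_subset w m)
  rw [Nat.card_eq_fintype_card, Fintype.card_coe] at h₁
  omega

theorem ncard_wordAlph_le (w : List α) : (wordAlph w).ncard ≤ (factors w 1).card := by
  rw [← Set.ncard_coe_finset]
  refine Set.ncard_le_ncard_of_injOn (fun a => [a]) (fun a ha => ?_) (fun a _ b _ h => by simpa using h)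
    (Finset.finite_toSet _)
  exact mem_factors.2 ⟨(List.singleton_infix_iff _ _).2 ha, rfl⟩

theorem sum_card_circuitTops_le (w : List α) :
    ∑ m ∈ Finset.range (w.length - 1), (circuitTops w (m + 1)).card + (wordAlph w).ncard ≤
      w.length := by
  have key : ∀ n < w.length, ∑ m ∈ Finset.range n, (circuitTops w (m + 1)).card +
      (factors w 1).card ≤ (factors w (n + 1)).card + n := by
    intro n
    induction n with
    | zero => simp
    | succ n ih =>
      intro hn
      have := card_circuitTops_add_card_factors_le (w := w) (m := n + 1) (by omega)
      have := ih (by omega)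
      rw [Finset.sum_range_succ]
      omega
  rcases Nat.eq_zero_or_pos w.length with h | h
  · simp [List.length_eq_zero_iff.1 h, wordAlph]
  · have h₁ := key (w.length - 1) (by omega)
    have h₂ : (factors w (w.length - 1 + 1)).card ≤ 1 := by
      refine Finset.card_image_le.trans ?_
      simp; omega
    have h₃ := ncard_wordAlph_le w
    omega

end Rauzy

/-! ### Counting powers by circuit orders -/

/-- Pigeonhole: the p - |R| + 1 residues reached by stepping back from `i` cannot all avoid `R`. -/
theorem exists_add_modEq_of_card_le {p : ℕ} {R : Finset ℕ} (hR : R ⊆ Finset.range p)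
    (hne : R.Nonempty) (i : ℕ) : ∃ s r, s + R.card ≤ p ∧ r ∈ R ∧ r + s ≡ i [MOD p] := by
  by_contra! hcon
  have hpos := hne.card_pos
  have hcard : R.card ≤ p := by simpa using Finset.card_le_card hR
  have hmaps : ∀ s ∈ Finset.range (p - R.card + 1), (i + (p - s)) % p ∈ Finset.range p \ R := by
    intro s hs
    rw [Finset.mem_range] at hs
    refine Finset.mem_sdiff.2 ⟨Finset.mem_range.2 (Nat.mod_lt _ (by omega)), fun hr => ?_⟩
    refine hcon s _ (by omega) hr ?_
    refine ((Nat.mod_modEq _ p).add_right s).trans ?_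
    rw [show i + (p - s) + s = i + p by omega]
    exact Nat.add_modEq_right
  have hinj : Set.InjOn (fun s => (i + (p - s)) % p) (Finset.range (p - R.card + 1)) := by
    intro s hs s' hs' h
    simp only [Finset.coe_range, Set.mem_Iio] at hs hs'
    have h₁ : p - s ≡ p - s' [MOD p] := Nat.ModEq.add_left_cancel' i h
    have h₂ := (h₁.add_right (s + s'))
    rw [show p - s + (s + s') = s' + p by omega, show p - s' + (s + s') = s + p by omega] at h₂
    exact (Nat.ModEq.eq_of_lt_of_lt (Nat.ModEq.add_right_cancel' p h₂) (by omega) (by omega)).symm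
  have := Finset.card_le_card_of_injOn _ hmaps hinj
  rw [Finset.card_sdiff_of_subset hR, Finset.card_range, Finset.card_range] at this
  omega

theorem window_congr_of_modEq {α : Type*} {f : ℕ → α} {i j : ℕ} (h : i ≡ j [MOD wordPeriod f])
    (L : ℕ) : window f i L = window f j L := by
  rw [← window_mod_wordPeriod, h, window_mod_wordPeriod]

theorem window_eq_wordPow {α : Type*} (f : ℕ → α) {u : List α} (hu : window f 0 u.length = u)
    (hper : ∀ i, f (i + u.length) = f i) (k : ℕ) : window f 0 (k * u.length) = wordPow u k := by
  induction k with
  | zero => simp [window, wordPow]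
  | succ k ih =>
    have hshift : window f (0 + u.length) (k * u.length) = window f 0 (k * u.length) :=
      window_eq_iff.2 fun j _ => by rw [zero_add, zero_add, add_comm, hper]
    rw [Nat.succ_mul, add_comm, window_append, hu, hshift, ih]
    simp [wordPow, List.replicate_succ]

section Count

variable {α : Type*} [LinearOrder α]

open Classical in
/-- The orders `m` for which `f` yields a small circuit of the Rauzy graph of `w` of order `m`. -/
noncomputable def circuitOrders (w : List α) (f : ℕ → α) : Finset ℕ :=
  (Finset.range w.length).filter fun m => wordPeriod f ≤ m ∧ HasCircuit w f m

theorem mul_card_le_card_circuitOrders {w : List α} {f : ℕ → α} (hf : 0 < wordPeriod f) {k : ℕ}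
    (hk : 1 < k) {P : Finset (List α)}
    (hP : ∀ x ∈ P, x <:+: w ∧ ∃ i e, 0 < e ∧ x = window f i (k * (e * wordPeriod f))) :
    (k - 1) * P.card ≤ (circuitOrders w f).card := by
  classical
  rcases P.eq_empty_or_nonempty with rfl | hne
  · simp
  set p := wordPeriod f with hp
  have hP' := fun x hx => (hP x hx).2
  choose! i e he hx using hP'
  obtain ⟨x₀, hx₀, hmax⟩ := P.exists_max_image e hne
  set E := e x₀ with hE
  set R := (Finset.range p).filter fun r => window f r (k * (E * p)) <:+: w with hR
  have hRmem : ∀ x ∈ P, e x = E → i x % p ∈ R := fun x hxP hxE =>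
    Finset.mem_filter.2 ⟨Finset.mem_range.2 (Nat.mod_lt _ hf), by
      rw [hp, window_mod_wordPeriod, ← hp, ← hxE, ← hx x hxP]; exact (hP x hxP).1⟩
  have hRsub : R ⊆ Finset.range p := Finset.filter_subset _ _
  have hRp : R.card ≤ p := by simpa using Finset.card_le_card hRsub
  -- Each exponent below the maximum `E` allows at most `p` conjugates; exponent `E` allows only
  -- those starting in `R`.
  have hcardP : P.card ≤ (E - 1) * p + R.card := by
    have hsub : P ⊆ (Finset.Icc 1 (E - 1) ×ˢ Finset.range p ∪ {E} ×ˢ R).image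
        fun y => window f y.2 (k * (y.1 * p)) := by
      intro x hxP
      refine Finset.mem_image.2 ⟨(e x, i x % p), ?_, ?_⟩
      · have h₁ := hmax x hxP
        have h₂ := he x hxP
        have h₃ := Nat.mod_lt (i x) hf
        rcases eq_or_ne (e x) E with h | h
        · exact Finset.mem_union_right _ (by simp [h, hRmem x hxP h])
        · refine Finset.mem_union_left _ ?_
          simp only [Finset.mem_product, Finset.mem_Icc, Finset.mem_range]
          omega
      · rw [hp, window_mod_wordPeriod, ← hp, ← hx x hxP]
    refine (Finset.card_le_card hsub).trans (Finset.card_image_le.trans ?_)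
    refine (Finset.card_union_le _ _).trans ?_
    simp
  -- Every position is at most `p - |R|` steps after a start in `R`, which leaves room for a window
  -- of length `k * E * p - (p - |R|)`.
  have hsub : Finset.Ico p (k * (E * p) + R.card - p) ⊆ circuitOrders w f := by
    intro m hm
    rw [Finset.mem_Ico] at hm
    have hcirc : HasCircuit w f m := by
      intro j
      obtain ⟨s, r, hs, hr, hmod⟩ := exists_add_modEq_of_card_le hRsub ⟨_, hRmem x₀ hx₀ rfl⟩ j
      rw [← window_congr_of_modEq hmod]
      exact mem_factors.2 ⟨(window_infix_window (L' := k * (E * p)) f (by omega)).trans (Finset.mem_filter.1 hr).2,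
        length_window _ _ _⟩
    have hlen := (mem_factors.1 (hcirc 0)).1.length_le
    rw [length_window] at hlen
    exact Finset.mem_filter.2 ⟨Finset.mem_range.2 hlen, hm.1, hcirc⟩
  have hcard := Finset.card_le_card hsub
  rw [Nat.card_Ico] at hcard
  refine le_trans ?_ hcard
  have hE1 : 0 < E := he x₀ hx₀
  obtain ⟨a, ha⟩ := Nat.exists_eq_add_of_lt hE1
  obtain ⟨b, rfl⟩ := Nat.exists_eq_add_of_lt hk
  rw [zero_add] at ha
  rw [ha] at hcardP ⊢
  refine (Nat.mul_le_mul_left _ hcardP).trans ?_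
  -- Here `b = k - 2`; the slack in the final inequality is `(E - 1) * p + b * (p - |R|)`.
  have := Nat.mul_le_mul_left b hRp
  rw [Nat.sub_sub]
  refine Nat.le_sub_of_add_le ?_
  simp only [Nat.add_sub_cancel]
  nlinarith

theorem exists_isNecklace_of_mem_kPowerFactors {w x : List α} {k : ℕ} (hx : x ∈ kPowerFactors k w) :
    ∃ f : ℕ → α, IsNecklace f ∧ ∃ i e, 0 < e ∧ x = window f i (k * (e * wordPeriod f)) := by
  obtain ⟨hne, -, u, rfl⟩ := hx
  have hu : 0 < u.length := by
    rw [List.length_pos_iff]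
    rintro rfl
    exact hne (by simp [wordPow])
  set f : ℕ → α := fun j => u[j % u.length]'(Nat.mod_lt _ hu) with hf
  have hper : ∀ i, f (i + u.length) = f i := fun i => by simp [hf]
  have hpre : window f 0 u.length = u :=
    List.ext_getElem (by simp) fun j _ h => by simp [hf, Nat.mod_eq_of_lt h]
  have hdvd := wordPeriod_dvd hper
  obtain ⟨g, hg, hgf, i, hfg⟩ := exists_isNecklace f (Nat.pos_of_dvd_of_pos hdvd hu)
  obtain ⟨e, he⟩ := hdvd
  refine ⟨g, hg, i, e, Nat.pos_of_ne_zero ?_, ?_⟩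
  · rintro rfl
    omega
  · rw [← window_eq_wordPow f hpre hper, hgf, mul_comm e, ← he]
    exact window_eq_iff.2 fun j _ => by rw [zero_add, hfg]

/-- The largest edge recovers both the order, from its length, and the necklace, since it covers a
full period. -/
theorem sum_card_circuitOrders_le (w : List α) {F : Finset (ℕ → α)} (hF : ∀ f ∈ F, IsNecklace f) :
    ∑ f ∈ F, (circuitOrders w f).card ≤
      ∑ m ∈ Finset.range (w.length - 1), (circuitTops w (m + 1)).card := by
  classical
  rw [← Finset.card_sigma]
  refine le_trans ?_ Finset.card_biUnion_le
  refine Finset.card_le_card_of_injOn (fun y => window y.1 0 (y.2 + 1)) ?_ ?_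
  · rintro ⟨f, m⟩ h
    obtain ⟨hfF, hm⟩ := Finset.mem_sigma.1 h
    obtain ⟨hmw, hpm, hcirc⟩ := Finset.mem_filter.1 hm
    rw [Finset.mem_range] at hmw
    dsimp only at hfF hmw hpm hcirc
    have hpos := (hF f hfF).1
    obtain ⟨m, rfl⟩ := Nat.exists_eq_add_of_lt (hpos.trans_le hpm)
    rw [zero_add] at *
    exact Finset.mem_biUnion.2 ⟨m, Finset.mem_range.2 (by omega),
      Finset.mem_filter.2 ⟨hcirc 0, f, hF f hfF, hpm, hcirc, rfl⟩⟩
  · rintro ⟨f, m⟩ h ⟨g, n⟩ h' heq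
    obtain ⟨hfF, hm⟩ := Finset.mem_sigma.1 h
    obtain ⟨hgF, hn⟩ := Finset.mem_sigma.1 h'
    have hpm := (Finset.mem_filter.1 hm).2.1
    have hpn := (Finset.mem_filter.1 hn).2.1
    dsimp only at hfF hgF hpm hpn heq
    obtain rfl : m = n := by simpa using congrArg List.length heq
    obtain rfl := (hF f hfF).eq_of_window_eq (hF g hgF) (by omega) (by omega) heq
    rfl

theorem mul_numKPowers_add_ncard_wordAlph_le {k : ℕ} (hk : 1 < k) (w : List α) :
    (k - 1) * numKPowers k w + (wordAlph w).ncard ≤ w.length := by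
  classical
  refine le_trans (Nat.add_le_add_right ?_ _) (sum_card_circuitTops_le w)
  set P := (kPowerFactors_finite k w).toFinset with hPdef
  have hP : ∀ x ∈ P, x ∈ kPowerFactors k w := fun x hx => (Set.Finite.mem_toFinset _).1 hx
  have hroot := fun x hx => exists_isNecklace_of_mem_kPowerFactors (hP x hx)
  have : Nonempty (ℕ → α) ∨ P = ∅ := by
    rcases P.eq_empty_or_nonempty with h | ⟨x, hx⟩
    · exact .inr h
    · exact .inl ⟨(hroot x hx).choose⟩
  rw [numKPowers, Set.ncard_eq_toFinset_card _ (kPowerFactors_finite k w), ← hPdef]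
  rcases this with _ | h
  swap
  · simp [h]
  choose! F hF hFx using hroot
  have hFmem : ∀ f ∈ P.image F, IsNecklace f := fun f hf => by
    obtain ⟨x, hx, rfl⟩ := Finset.mem_image.1 hf
    exact hF x hx
  refine le_trans ?_ (sum_card_circuitOrders_le w hFmem)
  rw [Finset.card_eq_sum_card_image F P, Finset.mul_sum]
  refine Finset.sum_le_sum fun f hf =>
    mul_card_le_card_circuitOrders (hFmem f hf).1 hk fun x hx => ?_
  obtain ⟨hxP, rfl⟩ := Finset.mem_filter.1 hx
  exact ⟨(hP x hxP).2.1, hFx x hxP⟩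

end Count

theorem numKPowers_le {α : Type*} {k : ℕ} (hk : 1 < k) (w : List α) :
    (numKPowers k w : ℚ) ≤ ((w.length : ℚ) - ((wordAlph w).ncard : ℚ)) / ((k : ℚ) - 1) := by
  classical
  -- Any linear order on the letters serves to define necklaces.
  let _ : LinearOrder α := linearOrderOfSTO WellOrderingRel
  have h := mul_numKPowers_add_ncard_wordAlph_le hk w
  have hk' : (1 : ℚ) < k := by exact_mod_cast hk
  rw [le_div_iff₀ (by linarith), le_sub_iff_add_le, mul_comm]
  have h' : (((k - 1) * numKPowers k w + (wordAlph w).ncard : ℕ) : ℚ) ≤ w.length := by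
    exact_mod_cast h
  simpa [Nat.cast_sub hk.le] using h'

theorem mainTheorem2 (k : ℕ) (hk : 1 < k) :
    (∀ (α : Type u) (w : List α),
      (numKPowers k w : ℚ) ≤ ((w.length : ℚ) - ((wordAlph w).ncard : ℚ)) / ((k : ℚ) - 1)) ∧
    (∀ n : ℕ, 1 ≤ n →
      (maxKPowers.{u} n k : ℚ) ≤ ((n : ℚ) - 1) / ((k : ℚ) - 1)) := by
  refine ⟨fun α w => numKPowers_le hk w, fun n hn => ?_⟩
  obtain ⟨α, w, rfl, hw⟩ := (maxKPowers_isGreatest.{u} n k).1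
  rw [← hw]
  refine (numKPowers_le hk w).trans ?_
  have hk' : (1 : ℚ) < k := by exact_mod_cast hk
  have halph : 1 ≤ (wordAlph w).ncard := by
    rw [Nat.one_le_iff_ne_zero, ne_eq, Set.ncard_eq_zero (wordAlph_finite w), ← ne_eq,
      ← Set.nonempty_iff_ne_empty]
    exact ⟨w[0], List.getElem_mem _⟩
  have halph' : (1 : ℚ) ≤ (wordAlph w).ncard := by exact_mod_cast halph
  gcongr
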